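/- Let $V=\{1,\dots,n\}$ and let $\sigma:\binom{V}{2}\to\{-1,+1\}$ be a labeling of the unordered pairs of distinct nodes. The cost $\Delta$ of a clustering (a partition of $V$) is the number of pairs $\{u,v\}$ such that either $\sigma(u,v)=-1$ and $u,v$ are in the same cluster, or $\sigma(u,v)=+1$ and $u,v$ are in different clusters; $\mathrm{OPT}=\mathrm{OPT}(\sigma)$ is the minimum cost over all clusterings. A (possibly randomized) learning algorithm does not know $\sigma$; it adaptively queries the labels of pairs, then stops and outputs a clustering. For a labeling $\sigma$, let $\mathbb{E}[Q]$ and $\mathbb{E}[\Delta]$ denote the expected number of its queries and the expected cost of its output, over its internal randomness. Let $\epsilon=\epsilon(n)$ be any function such that, for all sufficiently large $n$, $\frac{10}{9n}\le\epsilon(n)\le\frac12$ and $\frac{1}{\epsilon(n)}\in\mathbb{N}$. Then for every (possibly randomized) learning algorithm and every $n_0$ there exist $n\ge n_0$ and a labeling $\sigma$ on $n$ nodes such that the algorithm has expected error $$\mathbb{E}[\Delta]\ \ge\ \mathrm{OPT}+\frac{n^2\epsilon}{80}$$ whenever its expected number of queries on $\sigma$ satisfies $\mathbb{E}[Q]<\frac{n}{80\,\epsilon}$.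 -/

import Mathlib

open Filter MeasureTheory
open scoped ENNReal

universe u

namespace CorrClust

/-- The set `ℰ` of unordered pairs `{u, v}` of distinct nodes of an `n`-element node set. -/
abbrev NodePair (n : ℕ) : Type := {e : Sym2 (Fin n) // ¬ e.IsDiag}

/-- A binary similarity function `σ : ℰ → {-1, +1}`; the values are the two units of `ℤ`. -/
abbrev Labeling (n : ℕ) : Type := NodePair n → ℤˣ

/-- A clustering: a partition of the node set into nonempty, pairwise disjoint clusters. -/
abbrev Clustering (n : ℕ) : Type := Finpartition (Finset.univ : Finset (Fin n))

/-- The two endpoints of the pair `e` belong to the same cluster of `C`. -/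
def SameCluster {n : ℕ} (C : Clustering n) (e : NodePair n) : Prop :=
  ∃ S ∈ C.parts, ∀ v ∈ e.1, v ∈ S

/-- The set `Γ_C` of mistaken pairs of `C` with respect to `σ`. -/
def mistakes {n : ℕ} (σ : Labeling n) (C : Clustering n) : Set (NodePair n) :=
  {e | (σ e = -1 ∧ SameCluster C e) ∨ (σ e = 1 ∧ ¬ SameCluster C e)}

/-- The cost `Δ_C = |Γ_C|`. -/
noncomputable def cost {n : ℕ} (σ : Labeling n) (C : Clustering n) : ℕ :=
  (mistakes σ C).ncard

/-- The correlation clustering index: the minimum cost over all clusterings. -/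
noncomputable def opt {n : ℕ} (σ : Labeling n) : ℕ :=
  ⨅ C : Clustering n, cost σ C

/-- A deterministic adaptive algorithm on `n` nodes, as a decision tree: it either stops and
outputs a clustering, or it queries a pair and continues in a way that may depend on the answer
(and hence on the whole history of queries and answers). The same pair may be queried again. -/
inductive DetAlgorithm (n : ℕ) : Type
  | output (C : Clustering n) : DetAlgorithm n
  | query (e : NodePair n) (next : ℤˣ → DetAlgorithm n) : DetAlgorithm n

/-- The clustering returned when the queries are answered according to `σ`. -/
def DetAlgorithm.result {n : ℕ} (σ : Labeling n) : DetAlgorithm n → Clustering n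
  | .output C => C
  | .query e next => (next (σ e)).result σ

/-- The number of queries made when the queries are answered according to `σ`. -/
def DetAlgorithm.numQueries {n : ℕ} (σ : Labeling n) : DetAlgorithm n → ℕ
  | .output _ => 0
  | .query e next => (next (σ e)).numQueries σ + 1

/-- A randomized algorithm on `n` nodes: it draws a random seed (all its random bits) from an
arbitrary probability space and then proceeds as a deterministic adaptive algorithm. On every
labeling the returned clustering and the number of queries are random variables. -/
structure RandAlgorithm (n : ℕ) where
  Seed : Type u
  [mSeed : MeasurableSpace Seed]
  law : Measure Seed
  [isProb : IsProbabilityMeasure law]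
  run : Seed → DetAlgorithm n
  measurable_result : ∀ (σ : Labeling n) (C : Clustering n),
    MeasurableSet {ω : Seed | (run ω).result σ = C}
  measurable_numQueries : ∀ (σ : Labeling n) (m : ℕ),
    MeasurableSet {ω : Seed | (run ω).numQueries σ = m}

attribute [instance] RandAlgorithm.mSeed RandAlgorithm.isProb

/-- The expected number of queries `E[Q]` on `σ` (possibly infinite). -/
noncomputable def RandAlgorithm.expQueries {n : ℕ} (A : RandAlgorithm.{u} n) (σ : Labeling n) :
    ℝ≥0∞ :=
  ∫⁻ ω, ((A.run ω).numQueries σ : ℝ≥0∞) ∂A.law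

/-- The expected cost `E[Δ]` of the returned clustering on `σ`. -/
noncomputable def RandAlgorithm.expCost {n : ℕ} (A : RandAlgorithm.{u} n) (σ : Labeling n) :
    ℝ≥0∞ :=
  ∫⁻ ω, (cost σ ((A.run ω).result σ) : ℝ≥0∞) ∂A.law

end CorrClust

/-!
The hard instances hide a planted clustering with `k = 1/ε` clusters. Most nodes (nine tenths) form
`k` known *cores*, cliques of `+` edges that are joined to each other by `-` edges only; every
remaining *free* node `v` draws a home `h v ∈ Fin k` uniformly and independently, has `+` edges to
the core of its home, and `-` edges to all other cores and to all other free nodes.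

A query between `v` and core `j` only tells whether `h v = j`, and no other query is informative.
Hence, given any sequence of answers, `h` is still uniform on a product of sets of remaining
candidates, and locating the home of one free node takes about `k / 2` queries on average. The
potential `treePotential` turns this into a bound, by induction on the decision tree, on the number
of homes that an algorithm can guess in terms of its expected number of queries:
`sum_correct_le` gives `E[correct] ≤ b / k + (2 / k) E[Q]` for `b` free nodes.

An output clustering commits to a guess for each free node `v`: two distinct cores of size at least
`s` cannot both differ in fewer than `s` core nodes from the cluster of `v`, so all homes of `v` but
at most one cost at least `s` mistakes between `v` and the cores (`le_cost_add_correct`). The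
planted clustering only errs on pairs of free nodes with the same home, so the expected optimum is
at most `b (b - 1) / k` (`sum_opt_plantedLabeling_mul_le`). If an algorithm made fewer than
`n k / 80`
queries on every planted labeling and had excess below `n² / (80 k)` on all of them, averaging over
`h` would contradict these three estimates. Here `n = 20 N`, `b = 2 N`, and the `18 N ≥ k` core
nodes are distributed evenly, which makes `s = ⌊18 N / k⌋`.
-/

namespace CorrClust

open Finset

/-! ### The search potential -/

/-- An upper bound, scaled by `r`, on the best value of the game in which one of `r` equally likely
candidates is searched by membership queries that cost `2 / k` each, and a correct final guess pays
`1`. For `r ≥ 2` it is the solution of `ψ (r + 1) - ψ r = 1 - 2 (r + 1) / k` with `ψ k = 1`; the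
values at `0` and `1` are the true ones, since an identified candidate needs no further query. -/
noncomputable def searchPotential (k r : ℕ) : ℝ :=
  if r = 0 then 0 else if r = 1 then 1 else 2 + r - (r * (r + 1) : ℝ) / k

lemma searchPotential_nonneg {k r : ℕ} (h : r ≤ k) : 0 ≤ searchPotential k r := by
  unfold searchPotential
  split_ifs with h0 h1
  · rfl
  · norm_num
  · have hk : (0 : ℝ) < k := by exact_mod_cast (by omega : 0 < k)
    have hr : (r : ℝ) ≤ k := by exact_mod_cast h
    have : (r * (r + 1) : ℝ) / k ≤ r + 1 := by
      rw [div_le_iff₀ hk]; nlinarith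
    linarith

lemma one_le_searchPotential {k r : ℕ} (h0 : 0 < r) (h : r ≤ k) : 1 ≤ searchPotential k r := by
  unfold searchPotential
  rw [if_neg h0.ne']
  split_ifs with h1
  · rfl
  · have hk : (0 : ℝ) < k := by exact_mod_cast (by omega : 0 < k)
    have hr : (r : ℝ) ≤ k := by exact_mod_cast h
    have : (r * (r + 1) : ℝ) / k ≤ r + 1 := by
      rw [div_le_iff₀ hk]; nlinarith
    linarith

lemma searchPotential_self {k : ℕ} (hk : 0 < k) : searchPotential k k = 1 := by
  unfold searchPotential
  rw [if_neg hk.ne']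
  split_ifs with h1
  · rfl
  · have hk : (0 : ℝ) < k := by exact_mod_cast hk
    field_simp
    ring

/-- Querying one of `r + 1` candidates leaves either that candidate alone or the other `r`. -/
lemma searchPotential_step {k r : ℕ} (h : r + 1 ≤ k) :
    searchPotential k 1 + searchPotential k r - 2 / k * (r + 1 : ℝ) ≤
      searchPotential k (r + 1) := by
  have hk : (0 : ℝ) < k := by exact_mod_cast (by omega : 0 < k)
  have hk1 : (1 : ℝ) ≤ k := by exact_mod_cast (by omega : 1 ≤ k)
  rcases r with _ | _ | r
  · simp [searchPotential]
    positivity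
  · simp only [searchPotential]
    norm_num
    have h2 : 2 / (k : ℝ) ≤ 2 := by rw [div_le_iff₀ hk]; linarith
    have : (6 : ℝ) / k = 3 * (2 / k) := by ring
    linarith
  · simp only [searchPotential]
    rw [if_neg one_ne_zero, if_pos trivial, if_neg (by omega), if_neg (by omega),
      if_neg (by omega), if_neg (by omega)]
    push_cast
    apply le_of_eq
    field_simp
    ring

/-! ### Guessing the homes with few queries -/

section Tree

variable {n k : ℕ} {ι : Type*} [Fintype ι] [DecidableEq ι]

/-- The potential of the state in which every coordinate `v` of a uniform hidden function is known
to lie in `S v`: the sum over `v ∈ B` of the value of the search for coordinate `v`, multiplied by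
the number of functions in the product of the `S v` (so that it bounds sums, not averages). -/
noncomputable def treePotential (B : Finset ι) (S : ι → Finset (Fin k)) : ℝ :=
  ∑ v ∈ B, searchPotential k #(S v) * ∏ w ∈ univ.erase v, (#(S w) : ℝ)

lemma filter_piFinset_apply_eq (S : ι → Finset (Fin k)) {v : ι} {j : Fin k} (hj : j ∈ S v) :
    (Fintype.piFinset S).filter (fun h => h v = j) =
      Fintype.piFinset (Function.update S v {j}) := by
  ext h
  simp only [mem_filter, Fintype.mem_piFinset]
  constructor
  · rintro ⟨h1, h2⟩ w
    by_cases hw : w = v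
    · subst hw; simp [h2]
    · simp [hw, h1 w]
  · intro h1
    have hv : h v = j := by simpa using h1 v
    refine ⟨fun w => ?_, hv⟩
    by_cases hw : w = v
    · subst hw; rwa [hv]
    · simpa [hw] using h1 w

lemma filter_piFinset_apply_ne (S : ι → Finset (Fin k)) {v : ι} {j : Fin k} :
    (Fintype.piFinset S).filter (fun h => ¬ h v = j) =
      Fintype.piFinset (Function.update S v ((S v).erase j)) := by
  ext h
  simp only [mem_filter, Fintype.mem_piFinset]
  constructor
  · rintro ⟨h1, h2⟩ w
    by_cases hw : w = v
    · subst hw; simp [h2, h1 w]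
    · simp [hw, h1 w]
  · intro h1
    have hv : h v ≠ j ∧ h v ∈ S v := by simpa using h1 v
    refine ⟨fun w => ?_, hv.1⟩
    by_cases hw : w = v
    · subst hw; exact hv.2
    · simpa [hw] using h1 w

lemma card_piFinset_update (S : ι → Finset (Fin k)) (v : ι) (T : Finset (Fin k)) :
    (#(Fintype.piFinset (Function.update S v T)) : ℝ) =
      #T * ∏ w ∈ univ.erase v, (#(S w) : ℝ) := by
  rw [Fintype.card_piFinset, ← mul_prod_erase univ _ (mem_univ v)]
  push_cast
  rw [Function.update_self]
  congr 1
  exact prod_congr rfl fun w hw => by rw [Function.update_of_ne (ne_of_mem_erase hw)]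

lemma treePotential_split (B : Finset ι) (S : ι → Finset (Fin k)) {v : ι} {j : Fin k}
    (hv : v ∈ B) (hj : j ∈ S v) :
    treePotential B (Function.update S v {j}) +
        treePotential B (Function.update S v ((S v).erase j)) -
          2 / k * (#(Fintype.piFinset S) : ℝ) ≤ treePotential B S := by
  obtain ⟨r, hr⟩ : ∃ r, #(S v) = r + 1 := ⟨#(S v) - 1, by
    have := card_pos.2 ⟨j, hj⟩; omega⟩
  have hrk : r + 1 ≤ k := by rw [← hr]; simpa using card_le_univ (S v)
  have hcard : (#(Fintype.piFinset S) : ℝ) =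
      (r + 1 : ℝ) * ∏ w ∈ univ.erase v, (#(S w) : ℝ) := by
    have := card_piFinset_update S v (S v)
    rw [Function.update_eq_self, hr] at this
    rw [this]; push_cast; rfl
  -- As a function of the candidate set of `v` alone, the potential is `searchPotential` plus a
  -- term linear in the number of candidates, and the linear term is additive under the split.
  have hsplit : ∀ T : Finset (Fin k), treePotential B (Function.update S v T) =
      searchPotential k #T * ∏ w ∈ univ.erase v, (#(S w) : ℝ) +
        (#T : ℝ) * ∑ u ∈ B.erase v, searchPotential k #(S u) *
          ∏ w ∈ (univ.erase u).erase v, (#(S w) : ℝ) := by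
    intro T
    unfold treePotential
    rw [← add_sum_erase B _ hv, mul_sum]
    congr 1
    · rw [Function.update_self]
      congr 1
      exact prod_congr rfl fun w hw => by rw [Function.update_of_ne (ne_of_mem_erase hw)]
    · refine sum_congr rfl fun u hu => ?_
      have huv : v ∈ univ.erase u := mem_erase.2 ⟨(ne_of_mem_erase hu).symm, mem_univ _⟩
      rw [Function.update_of_ne (ne_of_mem_erase hu), ← mul_prod_erase _ _ huv,
        Function.update_self, prod_congr rfl (g := fun w => (#(S w) : ℝ))
          fun w hw => by rw [Function.update_of_ne (ne_of_mem_erase hw)]]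
      ring
  have hS := hsplit (S v)
  rw [Function.update_eq_self] at hS
  rw [hsplit, hsplit, hS, hcard, card_erase_of_mem hj, hr, card_singleton]
  have hP : (0 : ℝ) ≤ ∏ w ∈ univ.erase v, (#(S w) : ℝ) := prod_nonneg fun _ _ => by positivity
  have := mul_le_mul_of_nonneg_right (searchPotential_step hrk) hP
  simp only [Nat.add_sub_cancel]
  push_cast
  linarith

lemma sum_correct_le_treePotential (B : Finset ι) (S : ι → Finset (Fin k)) (g : ι → Fin k) :
    ∑ h ∈ Fintype.piFinset S, (#(B.filter fun v => h v = g v) : ℝ) ≤ treePotential B S := by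
  have hswap : ∑ h ∈ Fintype.piFinset S, (#(B.filter fun v => h v = g v) : ℝ) =
      ∑ v ∈ B, (#((Fintype.piFinset S).filter fun h => h v = g v) : ℝ) := by
    simp_rw [card_filter]
    push_cast
    exact sum_comm
  rw [hswap]
  refine sum_le_sum fun v _ => ?_
  have hP : (0 : ℝ) ≤ ∏ w ∈ univ.erase v, (#(S w) : ℝ) := prod_nonneg fun _ _ => by positivity
  have hcard : #(S v) ≤ k := by simpa using card_le_univ (S v)
  by_cases hg : g v ∈ S v
  · rw [filter_piFinset_apply_eq S hg, card_piFinset_update, card_singleton]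
    exact mul_le_mul_of_nonneg_right
      (by simpa using one_le_searchPotential (card_pos.2 ⟨_, hg⟩) hcard) hP
  · rw [filter_false_of_mem]
    · simpa using mul_nonneg (searchPotential_nonneg hcard) hP
    · intro h hh heq
      exact hg (heq ▸ Fintype.mem_piFinset.1 hh v)

/-- Correct guesses minus `2 / k` times the number of queries, summed over all hidden functions
compatible with the candidate sets `S`. The hypothesis `hσ` says that a label is either the same for
all hidden functions or tests a single value of one coordinate in `B`; this keeps the set of
compatible functions a product along every branch of the tree. -/
theorem sum_correct_sub_queries_le (B : Finset ι) (σ : (ι → Fin k) → Labeling n)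
    (hσ : ∀ e, (∃ c, ∀ h, σ h e = c) ∨
      ∃ v ∈ B, ∃ j, ∀ h, σ h e = if h v = j then 1 else -1)
    (g : Clustering n → ι → Fin k) (T : DetAlgorithm n) (S : ι → Finset (Fin k)) :
    ∑ h ∈ Fintype.piFinset S, ((#(B.filter fun v => h v = g (T.result (σ h)) v) : ℝ) -
      2 / k * (T.numQueries (σ h) : ℝ)) ≤ treePotential B S := by
  induction T generalizing S with
  | output C =>
    simp only [DetAlgorithm.result, DetAlgorithm.numQueries, Nat.cast_zero, mul_zero, sub_zero]
    exact sum_correct_le_treePotential B S (g C)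
  | query e next ih =>
    -- When the answer is determined, the query only adds its cost to the subtree it leads to.
    have hconst : ∀ (S : ι → Finset (Fin k)) (c : ℤˣ),
        (∀ h ∈ Fintype.piFinset S, σ h e = c) →
        ∑ h ∈ Fintype.piFinset S,
          ((#(B.filter fun v => h v = g ((DetAlgorithm.query e next).result (σ h)) v) : ℝ) -
            2 / k * ((DetAlgorithm.query e next).numQueries (σ h) : ℝ)) ≤
          treePotential B S - 2 / k * (#(Fintype.piFinset S) : ℝ) := by
      intro S c hc
      refine le_trans (le_of_eq ?_) (sub_le_sub_right (ih c S) _)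
      rw [mul_comm _ (#(Fintype.piFinset S) : ℝ), ← nsmul_eq_mul, ← sum_const, ← sum_sub_distrib]
      refine sum_congr rfl fun h hh => ?_
      simp only [DetAlgorithm.result, DetAlgorithm.numQueries, hc h hh]
      push_cast
      ring
    have hconst' : ∀ (S : ι → Finset (Fin k)) (c : ℤˣ),
        (∀ h ∈ Fintype.piFinset S, σ h e = c) →
        ∑ h ∈ Fintype.piFinset S,
          ((#(B.filter fun v => h v = g ((DetAlgorithm.query e next).result (σ h)) v) : ℝ) -
            2 / k * ((DetAlgorithm.query e next).numQueries (σ h) : ℝ)) ≤ treePotential B S :=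
      fun S c hc => (hconst S c hc).trans (sub_le_self _ (by positivity))
    obtain ⟨c, hc⟩ | ⟨v, hv, j, hj⟩ := hσ e
    · exact hconst' S c fun h _ => hc h
    by_cases hjS : j ∈ S v
    · have hsum := add_le_add
        (hconst (Function.update S v {j}) 1 fun h hh => by
          rw [hj, if_pos (by simpa using Fintype.mem_piFinset.1 hh v)])
        (hconst (Function.update S v ((S v).erase j)) (-1) fun h hh => by
          have := Fintype.mem_piFinset.1 hh v
          rw [Function.update_self] at this
          rw [hj, if_neg (ne_of_mem_erase this)])
      have hcard : (#(Fintype.piFinset (Function.update S v {j})) : ℝ) +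
          #(Fintype.piFinset (Function.update S v ((S v).erase j))) = #(Fintype.piFinset S) := by
        rw [← filter_piFinset_apply_eq S hjS, ← filter_piFinset_apply_ne S]
        exact_mod_cast card_filter_add_card_filter_not _
      have hpot := treePotential_split B S hv hjS
      rw [← hcard] at hpot
      have hparts := sum_filter_add_sum_filter_not (Fintype.piFinset S) (fun h => h v = j) fun h =>
        ((#(B.filter fun v => h v = g ((DetAlgorithm.query e next).result (σ h)) v) : ℝ) -
          2 / k * ((DetAlgorithm.query e next).numQueries (σ h) : ℝ))
      rw [filter_piFinset_apply_eq S hjS, filter_piFinset_apply_ne S] at hparts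
      linarith
    · refine hconst' S (-1) fun h hh => ?_
      rw [hj, if_neg]
      rintro rfl
      exact hjS (Fintype.mem_piFinset.1 hh v)

/-- With no prior information, an algorithm that averages `q` queries guesses on average at most
`#B / k + 2 q / k` of the coordinates in `B`. -/
theorem sum_correct_le (hk : 0 < k) (B : Finset ι) (σ : (ι → Fin k) → Labeling n)
    (hσ : ∀ e, (∃ c, ∀ h, σ h e = c) ∨
      ∃ v ∈ B, ∃ j, ∀ h, σ h e = if h v = j then 1 else -1)
    (g : Clustering n → ι → Fin k) (T : DetAlgorithm n) :
    ∑ h, (#(B.filter fun v => h v = g (T.result (σ h)) v) : ℝ) ≤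
      #B * (k : ℝ) ^ Fintype.card ι / k + 2 / k * ∑ h, (T.numQueries (σ h) : ℝ) := by
  have h := sum_correct_sub_queries_le B σ hσ g T fun _ => univ
  have hk' : (k : ℝ) ≠ 0 := by exact_mod_cast hk.ne'
  have hpot : treePotential B (fun _ : ι => (univ : Finset (Fin k))) =
      #B * (k : ℝ) ^ Fintype.card ι / k := by
    have hterm : ∀ v ∈ B, searchPotential k #(univ : Finset (Fin k)) *
        ∏ w ∈ (univ : Finset ι).erase v, (#(univ : Finset (Fin k)) : ℝ) =
          (k : ℝ) ^ Fintype.card ι / k := by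
      intro v _
      rw [card_univ, Fintype.card_fin, searchPotential_self hk, one_mul, eq_div_iff hk', mul_comm,
        mul_prod_erase univ (fun _ => (k : ℝ)) (mem_univ v), prod_const, card_univ]
    unfold treePotential
    rw [sum_congr rfl hterm, sum_const, nsmul_eq_mul, mul_div_assoc]
  rw [hpot, Fintype.piFinset_univ, sum_sub_distrib, ← mul_sum] at h
  linarith

end Tree

/-! ### Planted labelings -/

section Planted

variable {n k : ℕ}

/-- The cluster of node `u` in the planted clustering. The partial function `core` fixes the cluster
of the core nodes and is `none` on the free nodes, whose clusters are given by `h`; the values of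
`h` at core nodes play no role. -/
def home (core : Fin n → Option (Fin k)) (h : Fin n → Fin k) (u : Fin n) : Fin k :=
  (core u).getD (h u)

open Classical in
/-- The labeling in which a pair is positive when its two nodes have the same home and are not both
free. -/
noncomputable def plantedLabeling (core : Fin n → Option (Fin k)) (h : Fin n → Fin k) :
    Labeling n := fun e =>
  if (∃ u ∈ e.1, core u ≠ none) ∧ ∀ u ∈ e.1, ∀ v ∈ e.1, home core h u = home core h v
  then 1 else -1

/-- The core of cluster `i`. -/
def coreNodes (core : Fin n → Option (Fin k)) (i : Fin k) : Finset (Fin n) :=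
  univ.filter fun u => core u = some i

/-- The nodes that belong to no core. -/
def freeNodes (core : Fin n → Option (Fin k)) : Finset (Fin n) :=
  univ.filter fun u => core u = none

lemma plantedLabeling_mk (core : Fin n → Option (Fin k)) (h : Fin n → Fin k) {u v : Fin n}
    (huv : ¬ (s(u, v)).IsDiag) :
    plantedLabeling core h ⟨s(u, v), huv⟩ =
      if (core u ≠ none ∨ core v ≠ none) ∧ home core h u = home core h v then 1 else -1 := by
  unfold plantedLabeling
  congr 1
  simp only [Sym2.mem_iff, eq_iff_iff]
  grind

lemma sameCluster_mk (C : Clustering n) {u v : Fin n} (huv : ¬ (s(u, v)).IsDiag) :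
    SameCluster C ⟨s(u, v), huv⟩ ↔ u ∈ C.part v := by
  rw [Finpartition.mem_part_iff_exists]
  simp [SameCluster]

/-- A label either does not depend on the homes of the free nodes, or tests whether the home of one
free node is a given cluster. -/
lemma plantedLabeling_dependence (core : Fin n → Option (Fin k)) (e : NodePair n) :
    (∃ c, ∀ h, plantedLabeling core h e = c) ∨
      ∃ v ∈ freeNodes core, ∃ j, ∀ h,
        plantedLabeling core h e = if h v = j then 1 else -1 := by
  obtain ⟨e, he⟩ := e
  induction e using Sym2.ind with
  | _ u v =>
    simp only [plantedLabeling_mk, home, freeNodes, mem_filter, mem_univ, true_and]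
    obtain hu | ⟨i, hu⟩ := Option.eq_none_or_eq_some (core u) <;>
      obtain hv | ⟨j, hv⟩ := Option.eq_none_or_eq_some (core v)
    · exact .inl ⟨-1, fun h => by simp [hu, hv]⟩
    · exact .inr ⟨u, hu, j, fun h => by simp [hu, hv]⟩
    · exact .inr ⟨v, hv, i, fun h => by simp [hu, hv, eq_comm]⟩
    · exact .inl ⟨if i = j then 1 else -1, fun h => by simp [hu, hv]⟩

/-- The core nodes on which membership in `P` and membership in core `i` disagree; when `P` is the
cluster of a free node with home `i`, these are the ends of its mistaken pairs with core nodes. -/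
def coreMismatch (core : Fin n → Option (Fin k)) (P : Finset (Fin n)) (i : Fin k) :
    Finset (Fin n) :=
  univ.filter fun u => core u ≠ none ∧ ¬ (core u = some i ↔ u ∈ P)

lemma card_coreNodes_add_le (core : Fin n → Option (Fin k)) (P : Finset (Fin n)) {i j : Fin k}
    (hij : i ≠ j) :
    #(coreNodes core i) + #(coreNodes core j) ≤
      #(coreMismatch core P i) + #(coreMismatch core P j) := by
  have hdisj : Disjoint (coreNodes core i) (coreNodes core j) := by
    rw [disjoint_left]
    simp only [coreNodes, mem_filter, mem_univ, true_and]
    intro u hu hu'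
    exact hij (by simpa using hu.symm.trans hu')
  rw [← card_union_of_disjoint hdisj]
  refine (card_le_card fun u => ?_).trans (card_union_le _ _)
  simp only [coreNodes, coreMismatch, mem_union, mem_filter, mem_univ, true_and]
  rintro (hu | hu)
  · by_cases hP : u ∈ P <;> simp [hu, hP, hij]
  · by_cases hP : u ∈ P <;> simp [hu, hP, hij.symm]

/-- A set of nodes is close to at most one core. -/
lemma exists_guess [NeZero k] (core : Fin n → Option (Fin k)) {s : ℕ}
    (hs : ∀ i, s ≤ #(coreNodes core i)) (P : Finset (Fin n)) :
    ∃ g : Fin k, ∀ i, i ≠ g → s ≤ #(coreMismatch core P i) := by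
  by_cases hex : ∃ g, #(coreMismatch core P g) < s
  · obtain ⟨g, hg⟩ := hex
    refine ⟨g, fun i hi => ?_⟩
    have := card_coreNodes_add_le core P hi
    have := hs i
    have := hs g
    omega
  · push Not at hex
    exact ⟨0, fun i _ => hex i⟩

/-! ### The cost of an output and the optimum -/

lemma sum_card_coreMismatch_le_cost (core : Fin n → Option (Fin k)) (h : Fin n → Fin k)
    (C : Clustering n) :
    ∑ v ∈ freeNodes core, #(coreMismatch core (C.part v) (h v)) ≤
      cost (plantedLabeling core h) C := by
  classical
  have hmem : ∀ x : (_ : Fin n) × Fin n,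
      x ∈ (freeNodes core).sigma (fun v => coreMismatch core (C.part v) (h v)) ↔
        core x.1 = none ∧ core x.2 ≠ none ∧ ¬ (core x.2 = some (h x.1) ↔ x.2 ∈ C.part x.1) := by
    simp [freeNodes, coreMismatch]
  rw [← card_sigma, cost, ← Set.ncard_image_of_injective _ Subtype.val_injective,
    ← Set.ncard_coe_finset]
  refine Set.ncard_le_ncard_of_injOn (fun x => s(x.2, x.1)) ?_ ?_ (Set.toFinite _)
  · rintro ⟨v, u⟩ hx
    obtain ⟨hv, hu, hne⟩ := (hmem _).1 hx
    have hd : ¬ (s(u, v)).IsDiag := by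
      rw [Sym2.mk_isDiag_iff]; rintro rfl; exact hu hv
    refine ⟨⟨s(u, v), hd⟩, ?_, rfl⟩
    obtain ⟨i, hi⟩ := Option.ne_none_iff_exists'.1 hu
    simp only [mistakes, Set.mem_ofPred_eq, sameCluster_mk, plantedLabeling_mk, home]
    simp only [hi, hv] at hne ⊢
    by_cases hP : u ∈ C.part v <;> by_cases hih : i = h v <;> simp_all
  · rintro ⟨v, u⟩ hx ⟨v', u'⟩ hx' heq
    obtain ⟨hv, hu, -⟩ := (hmem _).1 hx
    obtain ⟨hv', hu', -⟩ := (hmem _).1 hx'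
    rcases Sym2.eq_iff.1 heq with ⟨h1, h2⟩ | ⟨h1, h2⟩
    · dsimp only at h1 h2
      rw [h1, h2]
    · dsimp only at h1 h2 hu hv'
      exact absurd (h1 ▸ hv') hu

/-- Every output clustering `C` implies a guess `g C v` for the home of each free node `v`, and each
wrong guess costs at least `s` mistakes. -/
theorem le_cost_add_correct [NeZero k] (core : Fin n → Option (Fin k)) {s : ℕ}
    (hs : ∀ i, s ≤ #(coreNodes core i)) :
    ∃ g : Clustering n → Fin n → Fin k, ∀ (h : Fin n → Fin k) (C : Clustering n),
      s * #(freeNodes core) ≤ cost (plantedLabeling core h) C +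
        s * #((freeNodes core).filter fun v => h v = g C v) := by
  choose g hg using exists_guess core hs
  refine ⟨fun C v => g (C.part v), fun h C => ?_⟩
  have hwrong : s * #((freeNodes core).filter fun v => ¬ h v = g (C.part v)) ≤
      cost (plantedLabeling core h) C := by
    refine le_trans ?_ (sum_card_coreMismatch_le_cost core h C)
    rw [mul_comm, ← smul_eq_mul]
    refine (card_nsmul_le_sum _ (fun v => #(coreMismatch core (C.part v) (h v))) s fun v hv =>
      hg _ _ (mem_filter.1 hv).2).trans ?_
    exact sum_le_sum_of_subset (filter_subset _ _)
  rw [← card_filter_add_card_filter_not (s := freeNodes core) (fun v => h v = g (C.part v)),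
    mul_add, add_comm]
  exact Nat.add_le_add_right hwrong _

/-- The planted clustering errs only on pairs of free nodes with the same home. Ordered pairs are
counted, which loses a factor of two. -/
lemma opt_plantedLabeling_le (core : Fin n → Option (Fin k)) (h : Fin n → Fin k) :
    opt (plantedLabeling core h) ≤
      #((freeNodes core).offDiag.filter fun p => h p.1 = h p.2) := by
  classical
  let C : Clustering n := Finpartition.ofSetoid (Setoid.ker (home core h))
  have hC : ∀ u v, u ∈ C.part v ↔ home core h v = home core h u := fun u v =>
    Finpartition.mem_part_ofSetoid_iff_rel
  refine (ciInf_le (OrderBot.bddBelow _) C).trans ?_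
  rw [cost, ← Set.ncard_image_of_injective _ Subtype.val_injective]
  refine le_trans (Set.ncard_le_ncard (t := (((freeNodes core).offDiag.filter
    fun p => h p.1 = h p.2).image fun p => s(p.1, p.2) : Finset (Sym2 (Fin n)))) ?_
      (finite_toSet _)) ((Set.ncard_coe_finset _).trans_le card_image_le)
  rintro _ ⟨⟨e, he⟩, hm, rfl⟩
  induction e using Sym2.ind with
  | _ u v =>
    have huv : u ≠ v := fun h' => he (by simp [h'])
    simp only [mistakes, Set.mem_ofPred_eq, sameCluster_mk, plantedLabeling_mk, hC] at hm
    have : core u = none ∧ core v = none ∧ home core h u = home core h v := by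
      by_cases hh : home core h u = home core h v <;>
      by_cases hu : core u = none <;> by_cases hv : core v = none <;>
        simp_all [eq_comm]
    obtain ⟨hu, hv, hh⟩ := this
    simp only [home, hu, hv, Option.getD_none] at hh
    simp only [coe_image, Set.mem_image, mem_coe, mem_filter, mem_offDiag]
    exact ⟨(u, v), ⟨⟨by simp [freeNodes, hu], by simp [freeNodes, hv], huv⟩, hh⟩, rfl⟩

lemma card_filter_apply_eq_mul_le {u v : Fin n} (huv : u ≠ v) :
    #((univ : Finset (Fin n → Fin k)).filter fun h => h u = h v) * k ≤ k ^ n := by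
  have hcard : #(((univ : Finset (Fin n → Fin k)).filter fun h => h u = h v) ×ˢ
      (univ : Finset (Fin k))) ≤ #(univ : Finset (Fin n → Fin k)) := by
    -- Overwriting `h u` by an arbitrary `c` is injective, as `h u` is recovered from `h v`.
    refine card_le_card_of_injOn (fun p => Function.update p.1 u p.2) (fun _ _ => by simp) ?_
    rintro ⟨h, c⟩ hh ⟨h', c'⟩ hh' heq
    simp only [coe_product, Set.mem_prod, mem_coe, mem_filter, mem_univ, true_and,
      and_true] at hh hh'
    have hall : ∀ w, w ≠ u → h w = h' w := fun w hw => by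
      simpa [hw] using congrFun heq w
    have hc : c = c' := by simpa using congrFun heq u
    refine Prod.ext (funext fun w => ?_) hc
    by_cases hw : w = u
    · subst hw; simp only [hh, hh', hall v huv.symm]
    · exact hall w hw
  simpa using hcard

/-- The sum, over all choices of homes, of the optimum: two free nodes collide with probability
`1 / k`. -/
theorem sum_opt_plantedLabeling_mul_le (core : Fin n → Option (Fin k)) :
    (∑ h, opt (plantedLabeling core h)) * k ≤
      (#(freeNodes core) * #(freeNodes core) - #(freeNodes core)) * k ^ n := by
  calc (∑ h, opt (plantedLabeling core h)) * k
      ≤ (∑ h : Fin n → Fin k,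
          #((freeNodes core).offDiag.filter fun p => h p.1 = h p.2)) * k :=
        Nat.mul_le_mul_right _ (sum_le_sum fun h _ => opt_plantedLabeling_le core h)
    _ = ∑ p ∈ (freeNodes core).offDiag,
          #((univ : Finset (Fin n → Fin k)).filter fun h => h p.1 = h p.2) * k := by
        simp_rw [card_filter]
        rw [sum_comm, sum_mul]
    _ ≤ ∑ _p ∈ (freeNodes core).offDiag, k ^ n :=
        sum_le_sum fun p hp => card_filter_apply_eq_mul_le (mem_offDiag.1 hp).2.2
    _ = _ := by rw [sum_const, offDiag_card, smul_eq_mul]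

/-! ### Cores of nearly equal size -/

/-- The first `m` nodes are core nodes, distributed over the `k` cores by their residue mod `k`; the
other nodes are free. -/
def cyclicCore (n k m : ℕ) [NeZero k] (u : Fin n) : Option (Fin k) :=
  if u.1 < m then some (Fin.ofNat k u) else none

lemma card_freeNodes_cyclicCore (n k m : ℕ) [NeZero k] (hm : m ≤ n) :
    #(freeNodes (cyclicCore n k m)) = n - m := by
  have : freeNodes (cyclicCore n k m) = univ.filter fun u : Fin n => ¬ u.1 < m := by
    ext u; simp [freeNodes, cyclicCore]
  have h2 := card_filter_add_card_filter_not (s := (univ : Finset (Fin n))) (fun u => u.1 < m)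
  rw [← this, card_univ, Fintype.card_fin, Fin.card_filter_val_lt, min_eq_right hm] at h2
  omega

lemma div_le_card_coreNodes_cyclicCore (n k m : ℕ) [NeZero k] (hm : m ≤ n) (i : Fin k) :
    m / k ≤ #(coreNodes (cyclicCore n k m) i) := by
  have hlt : ∀ t < m / k, k * t + i < m := fun t ht => by
    have h1 : k * (t + 1) ≤ k * (m / k) := Nat.mul_le_mul_left _ ht
    have h2 := Nat.mul_div_le m k
    have := i.2
    rw [mul_add, mul_one] at h1
    omega
  have := card_le_card_of_injOn (s := (univ : Finset (Fin (m / k))))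
    (t := coreNodes (cyclicCore n k m) i)
    (fun t => ⟨k * t + i, (hlt t t.2).trans_le hm⟩) ?_ ?_
  · simpa using this
  · intro t _
    refine mem_coe.2 (mem_filter.2 ⟨mem_univ _, ?_⟩)
    rw [cyclicCore, if_pos (hlt t t.2), Option.some.injEq]
    ext
    simp [Fin.ofNat, Nat.mod_eq_of_lt i.2]
  · intro t _ t' _ heq
    have h1 : k * t.1 + i.1 = k * t'.1 + i.1 := congrArg Fin.val heq
    exact Fin.ext (Nat.eq_of_mul_eq_mul_left (NeZero.pos k) (by omega))

end Planted

/-! ### The trade-off for algorithms -/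

lemma RandAlgorithm.measurable_cost_result {n : ℕ} (A : RandAlgorithm.{u} n) (σ : Labeling n) :
    Measurable fun ω => (cost σ ((A.run ω).result σ) : ℝ≥0∞) := by
  let _ : MeasurableSpace (Clustering n) := ⊤
  have hres : Measurable fun ω => (A.run ω).result σ :=
    measurable_to_countable' fun C => A.measurable_result σ C
  exact (measurable_from_top (f := fun C : Clustering n => (cost σ C : ℝ≥0∞))).comp hres

lemma RandAlgorithm.measurable_queries {n : ℕ} (A : RandAlgorithm.{u} n) (σ : Labeling n) :
    Measurable fun ω => ((A.run ω).numQueries σ : ℝ≥0∞) := by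
  have hres : Measurable fun ω => (A.run ω).numQueries σ :=
    measurable_to_countable' fun C => A.measurable_numQueries σ C
  exact (measurable_from_top (f := fun m : ℕ => (m : ℝ≥0∞))).comp hres

/-- Every deterministic algorithm with few queries on average over the choice of homes has a high
cost on average. -/
theorem DetAlgorithm.cost_query_tradeoff {n k : ℕ} [NeZero k] (core : Fin n → Option (Fin k))
    {s : ℕ} (hs : ∀ i, s ≤ #(coreNodes core i)) (T : DetAlgorithm n) :
    (s : ℝ) * #(freeNodes core) * (k : ℝ) ^ n * (1 - 1 / k) ≤
      ∑ h, (cost (plantedLabeling core h) (T.result (plantedLabeling core h)) : ℝ) +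
        2 * s / k * ∑ h, (T.numQueries (plantedLabeling core h) : ℝ) := by
  obtain ⟨g, hg⟩ := le_cost_add_correct core hs
  have hcorrect := sum_correct_le (NeZero.pos k) (freeNodes core) (plantedLabeling core)
    (plantedLabeling_dependence core) g T
  have hcost := sum_le_sum fun h (_ : h ∈ (univ : Finset (Fin n → Fin k))) =>
    (Nat.cast_le (α := ℝ)).2 (hg h (T.result (plantedLabeling core h)))
  push_cast at hcost
  rw [sum_add_distrib, sum_const, ← mul_sum, card_univ, Fintype.card_fun, Fintype.card_fin,
    Fintype.card_fin, nsmul_eq_mul] at hcost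
  rw [Fintype.card_fin] at hcorrect
  rw [Nat.cast_pow] at hcost
  have := mul_le_mul_of_nonneg_left hcorrect (Nat.cast_nonneg (α := ℝ) s)
  have e1 : (s : ℝ) * #(freeNodes core) * (k : ℝ) ^ n * (1 - 1 / k) =
      (k : ℝ) ^ n * (s * #(freeNodes core)) - s * (#(freeNodes core) * (k : ℝ) ^ n / k) := by
    ring
  rw [e1]
  linarith [show (2 * s / k : ℝ) * ∑ h, (T.numQueries (plantedLabeling core h) : ℝ) =
    s * (2 / k * ∑ h, (T.numQueries (plantedLabeling core h) : ℝ)) by ring]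

/-- The trade-off for deterministic algorithms, integrated over the seed. -/
theorem RandAlgorithm.cost_query_tradeoff {n k : ℕ} [NeZero k] (core : Fin n → Option (Fin k))
    {s : ℕ} (hs : ∀ i, s ≤ #(coreNodes core i)) (A : RandAlgorithm.{u} n) :
    ENNReal.ofReal ((s : ℝ) * #(freeNodes core) * (k : ℝ) ^ n * (1 - 1 / k)) ≤
      ∑ h, A.expCost (plantedLabeling core h) +
        ENNReal.ofReal (2 * s / k) * ∑ h, A.expQueries (plantedLabeling core h) := by
  have hpt : ∀ ω, ENNReal.ofReal ((s : ℝ) * #(freeNodes core) * (k : ℝ) ^ n * (1 - 1 / k)) ≤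
      ∑ h, (cost (plantedLabeling core h) ((A.run ω).result (plantedLabeling core h)) : ℝ≥0∞) +
        ENNReal.ofReal (2 * s / k) *
          ∑ h, ((A.run ω).numQueries (plantedLabeling core h) : ℝ≥0∞) := fun ω => by
    refine (ENNReal.ofReal_le_ofReal ((A.run ω).cost_query_tradeoff core hs)).trans_eq ?_
    rw [ENNReal.ofReal_add (by positivity) (by positivity), ENNReal.ofReal_mul (by positivity)]
    simp only [← Nat.cast_sum, ENNReal.ofReal_natCast]
  have hcost : Measurable fun ω => ∑ h, (cost (plantedLabeling core h)
      ((A.run ω).result (plantedLabeling core h)) : ℝ≥0∞) :=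
    Finset.measurable_fun_sum _ fun h _ => A.measurable_cost_result _
  have hquery : Measurable fun ω =>
      ∑ h, ((A.run ω).numQueries (plantedLabeling core h) : ℝ≥0∞) :=
    Finset.measurable_fun_sum _ fun h _ => A.measurable_queries _
  calc ENNReal.ofReal ((s : ℝ) * #(freeNodes core) * (k : ℝ) ^ n * (1 - 1 / k))
      = ∫⁻ _, ENNReal.ofReal ((s : ℝ) * #(freeNodes core) * (k : ℝ) ^ n * (1 - 1 / k)) ∂A.law := by
        rw [lintegral_const, measure_univ, mul_one]
    _ ≤ _ := lintegral_mono hpt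
    _ = _ := by
        rw [lintegral_add_left hcost, lintegral_const_mul _ hquery,
          lintegral_finsetSum _ fun h _ => A.measurable_cost_result _,
          lintegral_finsetSum _ fun h _ => A.measurable_queries _]
        rfl

/-- The size `⌊18 N / k⌋` of the cores is large enough for the final estimate, whatever the rounding.
For `k = 2` equality holds, so the rounding must be exact there. -/
lemma core_size_bound {N k : ℕ} (hk2 : 2 ≤ k) (hk : k ≤ 18 * N) :
    18 * N ≤ (18 * N / k) * (3 * k - 4) := by
  have hkpos : 0 < k := by omega
  have hs1 : 1 ≤ 18 * N / k := Nat.div_pos hk hkpos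
  have hlt : 18 * N < k * (18 * N / k + 1) := Nat.lt_mul_div_succ _ hkpos
  obtain rfl | rfl | hk4 : k = 2 ∨ k = 3 ∨ 4 ≤ k := by omega
  · omega
  · omega
  · have h1 : 18 * N / k * (2 * k) ≤ 18 * N / k * (3 * k - 4) :=
      Nat.mul_le_mul_left _ (by omega)
    nlinarith

/-- Clearing denominators, the final estimate for `b = 2 N` reads `18 N - 4 < s (3 k - 4)`. -/
theorem exists_hard_labeling {n N k : ℕ} (hn : n = 20 * N) (hN : 0 < N) (hk2 : 2 ≤ k)
    (hk : k ≤ 18 * N) (A : RandAlgorithm.{u} n) :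
    ∃ σ : Labeling n, A.expQueries σ < ENNReal.ofReal (n * k / 80 : ℝ) →
      ENNReal.ofReal ((opt σ : ℝ) + (n : ℝ) ^ 2 / (80 * k)) ≤ A.expCost σ := by
  by_contra! hcon
  have : NeZero k := ⟨by omega⟩
  obtain ⟨s, hs⟩ : ∃ s, s = 18 * N / k := ⟨_, rfl⟩
  have hm : 18 * N ≤ n := by omega
  let core := cyclicCore n k (18 * N)
  have htrade := A.cost_query_tradeoff core (s := s) fun i =>
    hs.trans_le (div_le_card_coreNodes_cyclicCore n k _ hm i)
  have hopt := sum_opt_plantedLabeling_mul_le core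
  have hfree : #(freeNodes core) = 2 * N := by
    rw [card_freeNodes_cyclicCore n k _ hm]; omega
  rw [hfree] at htrade hopt
  have hkpos : (0 : ℝ) < k := by exact_mod_cast (by omega : 0 < k)
  have hcost : ∑ h, A.expCost (plantedLabeling core h) ≤
      ENNReal.ofReal (∑ h, ((opt (plantedLabeling core h) : ℝ) + (n : ℝ) ^ 2 / (80 * k))) := by
    rw [ENNReal.ofReal_sum_of_nonneg fun _ _ => by positivity]
    exact sum_le_sum fun h _ => (hcon _).2.le
  have hquery : ∑ h, A.expQueries (plantedLabeling core h) ≤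
      ENNReal.ofReal (∑ _h : Fin n → Fin k, (n * k / 80 : ℝ)) := by
    rw [ENNReal.ofReal_sum_of_nonneg fun _ _ => by positivity]
    exact sum_le_sum fun h _ => (hcon _).1.le
  have hreal := htrade.trans (add_le_add hcost (mul_le_mul_right hquery _))
  rw [← ENNReal.ofReal_mul (by positivity), ← ENNReal.ofReal_add (by positivity) (by positivity),
    ENNReal.ofReal_le_ofReal_iff (by positivity), sum_add_distrib, sum_const, sum_const, card_univ,
    Fintype.card_fun, Fintype.card_fin, Fintype.card_fin, nsmul_eq_mul, nsmul_eq_mul] at hreal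
  have hoptR : (∑ h, (opt (plantedLabeling core h) : ℝ)) * k ≤
      (2 * N * (2 * N) - 2 * N) * (k : ℝ) ^ n := by
    have h1 : 2 * N ≤ 2 * N * (2 * N) := Nat.le_mul_of_pos_right _ (by omega)
    have := (Nat.cast_le (α := ℝ)).2 hopt
    rw [Nat.cast_mul, Nat.cast_mul, Nat.cast_sub h1] at this
    push_cast at this
    exact this
  have hsize : (18 * N : ℝ) ≤ s * (3 * k - 4) := by
    have := (Nat.cast_le (α := ℝ)).2 (core_size_bound hk2 hk)
    rw [← hs, Nat.cast_mul s, Nat.cast_sub (by omega)] at this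
    push_cast at this
    exact this
  have hNR : (0 : ℝ) < N := by exact_mod_cast hN
  have hP : (0 : ℝ) < (k : ℝ) ^ n := by positivity
  have hnR : (n : ℝ) = 20 * N := by rw [hn]; push_cast; rfl
  push_cast at hreal
  have hmul := mul_le_mul_of_nonneg_right hreal hkpos.le
  have e1 : (s : ℝ) * (2 * N) * (k : ℝ) ^ n * (1 - 1 / k) * k =
      (k : ℝ) ^ n * (2 * N * (s * (k - 1))) := by
    field_simp
  have e2 : (∑ h, (opt (plantedLabeling core h) : ℝ) + (k : ℝ) ^ n * ((n : ℝ) ^ 2 / (80 * k)) +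
      2 * s / k * ((k : ℝ) ^ n * (n * k / 80))) * k =
      (∑ h, (opt (plantedLabeling core h) : ℝ)) * k +
        (k : ℝ) ^ n * (5 * N ^ 2 + s * k * N / 2) := by
    have hk0 := hkpos.ne'
    generalize (k : ℝ) ^ n = P
    rw [hnR]
    field_simp
    ring
  rw [e1, e2] at hmul
  have hfin : (k : ℝ) ^ n * (2 * N * (s * (k - 1))) ≤
      (k : ℝ) ^ n * (2 * N * (2 * N) - 2 * N + (5 * N ^ 2 + s * k * N / 2)) := by
    linarith
  have := le_of_mul_le_mul_left hfin hP
  have := mul_le_mul_of_nonneg_left hsize hNR.le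
  nlinarith

end CorrClust

theorem theorem9 (ε : ℕ → ℝ)
    (hε : ∀ᶠ n : ℕ in atTop,
      10 / (9 * (n : ℝ)) ≤ ε n ∧ ε n ≤ 1 / 2 ∧ ∃ k : ℕ, 1 / ε n = (k : ℝ))
    (A : ∀ n : ℕ, CorrClust.RandAlgorithm.{u} n) (n₀ : ℕ) :
    ∃ n : ℕ, n₀ ≤ n ∧ ∃ σ : CorrClust.Labeling n,
      (A n).expQueries σ < ENNReal.ofReal ((n : ℝ) / (80 * ε n)) →
        ENNReal.ofReal ((CorrClust.opt σ : ℝ) + (n : ℝ) ^ 2 * ε n / 80) ≤ (A n).expCost σ := by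
  obtain ⟨n₁, hn₁⟩ := eventually_atTop.1 hε
  obtain ⟨N, hN, hN₀, hN₁⟩ : ∃ N : ℕ, 0 < N ∧ n₀ ≤ 20 * N ∧ n₁ ≤ 20 * N :=
    ⟨n₀ + n₁ + 1, by omega, by omega, by omega⟩
  obtain ⟨hlow, hhigh, k, hk⟩ := hn₁ (20 * N) hN₁
  have hNR : (0 : ℝ) < N := by exact_mod_cast hN
  have hpos : 0 < ε (20 * N) := lt_of_lt_of_le (by positivity) hlow
  have hεk : ε (20 * N) = 1 / k := by rw [← hk, one_div_one_div]
  have hkpos : (0 : ℝ) < k := by rw [← hk]; positivity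
  have hk2 : 2 ≤ k := by
    rw [hεk, div_le_div_iff₀ hkpos (by norm_num)] at hhigh
    exact_mod_cast (by linarith : (2 : ℝ) ≤ k)
  have hkN : k ≤ 18 * N := by
    rw [hεk, div_le_div_iff₀ (by positivity) hkpos] at hlow
    push_cast at hlow
    exact_mod_cast (by linarith : (k : ℝ) ≤ 18 * N)
  obtain ⟨σ, hσ⟩ := CorrClust.exists_hard_labeling rfl hN hk2 hkN (A (20 * N))
  refine ⟨20 * N, hN₀, σ, fun hq => ?_⟩
  have e1 : ((20 * N : ℕ) : ℝ) / (80 * ε (20 * N)) = (20 * N : ℕ) * k / 80 := by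
    rw [hεk]; field_simp
  have e2 : ((20 * N : ℕ) : ℝ) ^ 2 * ε (20 * N) / 80 = ((20 * N : ℕ) : ℝ) ^ 2 / (80 * k) := by
    rw [hεk]; field_simp
  rw [e1] at hq
  rw [e2]
  exact hσ hq
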